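/- **Setting.** Requests $\langle \mathrm{Insert}, name, w\rangle$ (integer length $w\ge 1$, name not in use) and $\langle\mathrm{Delete}, name\rangle$ (of an active object) arrive online, starting from an empty array. An object is active from the start of the request that inserts it until the request that deletes it has been completed. $V$ is the total length and $\Delta$ the largest length of the objects active at the moment considered. Fix $0<\varepsilon'\le 1/2$. **Data structure.** Size class $i$ consists of the lengths $w$ with $2^{i-1}\le w<2^i$. The array is a sequence of regions, one for each class up to the largest class of an active object, in increasing order; region $i$ is a payload segment of some size $P(i)$ holding only objects of class $i$, followed by a buffer segment of size $\lfloor\varepsilon' P(i)\rfloor$. *Insert* of an object of class $i$: if $i$ is larger than all existing classes, a new last region with the object as its payload ($P(i)=w$) is created (classes in between get empty regions). Otherwise the object is put at the end of the contents of the earliest buffer $j\ge i$ that has $w$ unoccupied cells; if there is none, it is put at the end of the contents of the last buffer, exceeding its capacity, and a flush is triggered. *Delete* of an object of class $i$: its space becomes a hole that stays occupied until the next flush of the segment containing it, and a dummy delete record of size $w$ is put into the earliest buffer $j\ge i$ with $w$ unoccupied cells; if there is none, a flush is triggered (without a record). *Flush.* Let $b$ be the largest class such that the triggering object and all objects with an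 insertion or a delete record in a buffer $i\ge b$ belong to classes $\ge b$. After the flush, for each $i\ge b$ the payload segment of class $i$ contains exactly the remaining objects of class $i$ without gaps (those that were in the payload, followed by the buffered ones), so $P(i)$ is their volume, and the buffer of class $i$ is empty, of size $\lfloor\varepsilon' P(i)\rfloor$; the regions of classes $<b$ are unchanged, and empty regions at the end disappear. Let $w$ be the size of the triggering insertion ($w=0$ for a deletion), $L$ the end of the contents of the last buffer before the triggering request, $L'$ the space of the data structure after the flush minus $w$, $B$ the total size of the buffers $i\ge b$ before the flush, and $M=\max\{L,L'\}+B+\Delta$. (1) All objects in buffers $i\ge b$ (including the newly inserted one), in any order, are moved to consecutive locations starting at $M$. (2) The payload objects of classes $\ge b$, from the last to the first, are moved so that they end up contiguous and ending at $M$; this happens in phases, each moving as many objects as possible of total volume at most $B+\Delta$. (3) The same objects, from the first to the last, are moved to their final locations, in phases that each fill a stretch of at most $B+\Delta$ cells. (4) The buffered objects are moved to their final locations. Each of (1), (4), and every phase of (2) and (3), is followed by a checkpoint; the old location of a moved object remains occupied until the next checkpoint. The *footprint* at a moment is the end of the used part of the array, where all segments (including their unoccupied cells; during a flush, both the old and the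 new segments), all stored objects, and all copies freed since the last checkpoint count as used. **Lemma.** There is an absolute constant $C>0$ such that for every $0<\varepsilon'\le 1/2$ and every sequence of requests as above, at every moment of the processing of every request, including every moment in the middle of a flush, the footprint is at most $(1+C\varepsilon')V+\Delta$. -/

import Mathlib

namespace Realloc

/-! ### Requests, active objects -/

/-- An object with its name and its (integral) length. -/
structure Obj where
  name : ℕ
  size : ℕ
deriving DecidableEq

/-- An online request. -/
inductive Request where
  | insert (name length : ℕ)
  | delete (name : ℕ)

/-- The active objects once a request has been completed. -/
def activeStep (A : List Obj) : Request → List Obj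
  | .insert n w => A ++ [⟨n, w⟩]
  | .delete n => A.filter (fun o => o.name ≠ n)

/-- A request makes sense if it inserts an object of positive length under a name that is not in
use, or deletes an active object. -/
def Request.Admissible (A : List Obj) : Request → Prop
  | .insert n w => 1 ≤ w ∧ ∀ o ∈ A, o.name ≠ n
  | .delete n => ∃ o ∈ A, o.name = n

/-- A sequence of requests makes sense when `A` is the list of active objects at its start. -/
def Admissible : List Obj → List Request → Prop
  | _, [] => True
  | A, q :: qs => q.Admissible A ∧ Admissible (activeStep A q) qs

/-- Total length of a list of objects. -/
def volume (A : List Obj) : ℕ := (A.map Obj.size).sum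

/-- Length of the longest object of a list (`0` for the empty list). -/
def longest (A : List Obj) : ℕ := (A.map Obj.size).foldr max 0

/-- Size class `i` consists of the lengths `w` with `2 ^ i ≤ w < 2 ^ (i + 1)`;
classes are counted from `0`. -/
def sizeClass (w : ℕ) : ℕ := Nat.log 2 w

/-! ### Segments, regions, and the layout of the array -/

/-- What a stretch of a segment is used for: an object that is stored there, the hole left by an
object that has been deleted since, or a dummy delete record for an object (which takes as much
space as the object).  Delete records occur in buffer segments only. -/
inductive Slot where
  | obj (o : Obj)
  | hole (w : ℕ)
  | record (o : Obj)

def Slot.size : Slot → ℕ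
  | .obj o => o.size
  | .hole w => w
  | .record o => o.size

/-- The object stored in a slot, if any. -/
def Slot.stored : Slot → Option Obj
  | .obj o => some o
  | .hole _ => none
  | .record _ => none

/-- The object that is the subject of a buffered insertion or deletion. -/
def Slot.subject : Slot → Option Obj
  | .obj o => some o
  | .hole _ => none
  | .record o => some o

/-- Total size of consecutive slots. -/
def slotsSize (l : List Slot) : ℕ := (l.map Slot.size).sum

/-- A region: a payload segment, completely filled by its slots, followed by a buffer segment,
filled by its slots from the left. -/
structure Region where
  payload : List Slot
  buffer : List Slot

def Region.payloadSize (r : Region) : ℕ := slotsSize r.payload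

/-- Occupied space of the buffer (holes and delete records count). -/
def Region.used (r : Region) : ℕ := slotsSize r.buffer

/-- Size `⌊ε P⌋` of the buffer segment, `P` being the size of the payload segment.  As holes stay
until the next flush of the region, `P` is the volume of the size class at its last flush. -/
noncomputable def Region.capacity (ε : ℝ) (r : Region) : ℕ := ⌊ε * (r.payloadSize : ℝ)⌋₊

/-- Space of a region. -/
noncomputable def Region.space (ε : ℝ) (r : Region) : ℕ := r.payloadSize + r.capacity ε

def Region.payloadObjs (r : Region) : List Obj := r.payload.filterMap Slot.stored

def Region.bufferObjs (r : Region) : List Obj := r.buffer.filterMap Slot.stored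

/-- The data structure between flushes: the `i`-th region (from `0`) is that of size class `i`. -/
abbrev State := List Region

/-- Space taken by all regions, i.e. the end of the last buffer segment. -/
noncomputable def space (ε : ℝ) (R : State) : ℕ := (R.map (Region.space ε)).sum

/-- A copy of an object in the array, occupying the cells `addr, …, addr + obj.size - 1`. -/
structure Block where
  obj : Obj
  addr : ℕ

/-- First cell behind a block. -/
def Block.endpoint (x : Block) : ℕ := x.addr + x.obj.size

/-- The objects stored in consecutive slots, the first of which starts at the given address. -/
def placeSlots : ℕ → List Slot → List Block
  | _, [] => []
  | a, .obj o :: l => ⟨o, a⟩ :: placeSlots (a + o.size) l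
  | a, .hole w :: l => placeSlots (a + w) l
  | a, .record o :: l => placeSlots (a + o.size) l

/-- The given objects, stored contiguously from the given address on. -/
def placeObjs (a : ℕ) (l : List Obj) : List Block := placeSlots a (l.map Slot.obj)

/-- The locations of all objects, the first region starting at the given address. -/
noncomputable def layout (ε : ℝ) : ℕ → State → List Block
  | _, [] => []
  | a, r :: R =>
      placeSlots a r.payload ++ placeSlots (a + r.payloadSize) r.buffer ++
        layout ε (a + r.space ε) R

/-! ### Buffering insertions and deletions -/

/-- Append a slot to the `j`-th buffer. -/
def appendToBuffer (j : ℕ) (s : Slot) (R : State) : State :=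
  R.modify j (fun r => { r with buffer := r.buffer ++ [s] })

/-- The earliest buffer of index at least `c` with at least `w` unoccupied cells. -/
noncomputable def findBuffer (ε : ℝ) (R : State) (c w : ℕ) : Option ℕ :=
  (List.range R.length).find? fun j =>
    decide (c ≤ j ∧ ∃ r ∈ R[j]?, r.used + w ≤ r.capacity ε)

/-- Replace the object of the given name by a hole. -/
def Slot.erase (n : ℕ) : Slot → Slot
  | .obj o => if o.name = n then .hole o.size else .obj o
  | .hole w => .hole w
  | .record o => .record o

def eraseObj (n : ℕ) (R : State) : State :=
  R.map fun r => ⟨r.payload.map (Slot.erase n), r.buffer.map (Slot.erase n)⟩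

/-! ### The buffer flush -/

/-- The elementary actions of a flush: writing a copy of an object at a new location (the old copy
is freed), and waiting for a checkpoint. -/
inductive Action where
  | move (x : Block)
  | checkpoint

/-- The boundary size class: the largest `b` such that the triggering object (of class `c`) and
all objects with an insertion or deletion in a buffer `i ≥ b` belong to classes `≥ b`. -/
def boundary (R : State) (c : ℕ) : ℕ :=
  Nat.findGreatest
    (fun b => ∀ r ∈ R.drop b, ∀ o ∈ r.buffer.filterMap Slot.subject, b ≤ sizeClass o.size) c

/-- End of the last slot in the last buffer (which may exceed the buffer's capacity). -/
noncomputable def contentEnd (ε : ℝ) (R : State) : ℕ :=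
  space ε R.dropLast + (R.getLast?.map fun r => r.payloadSize + r.used).getD 0

/-- The moves of the packing step in the given order, broken into phases of total volume as large
as possible but at most `bound`, each followed by a checkpoint.  The first argument after `bound`
is the volume already moved in the present phase. -/
def packPhases (bound : ℕ) : ℕ → List Block → List Action
  | _, [] => [.checkpoint]
  | v, x :: l =>
      if v + x.obj.size ≤ bound then .move x :: packPhases bound (v + x.obj.size) l
      else .checkpoint :: .move x :: packPhases bound x.obj.size l

/-- The moves of the unpacking step in the given order, broken into phases, each of which fills
target locations within a stretch of at most `bound` cells and is followed by a checkpoint.  The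
first argument after `bound` is the start of the present stretch. -/
def unpackPhases (bound : ℕ) : ℕ → List Block → List Action
  | _, [] => [.checkpoint]
  | a, x :: l =>
      if x.endpoint ≤ a + bound then .move x :: unpackPhases bound a l
      else .checkpoint :: .move x :: unpackPhases bound x.addr l

/-- The buffered objects of the flushed regions, in the order in which they are moved. -/
def evacuated (order : List Obj → List Obj) (b : ℕ) (R : State) : List Obj :=
  order ((R.drop b).flatMap Region.bufferObjs)

/-- The data structure after a flush of all classes `≥ b`: the payload segment of each of these
classes consists of the objects that it stored before, followed by the buffered objects of the
class, and its buffer is empty.  Empty regions at the end disappear. -/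
def flushed (order : List Obj → List Obj) (b : ℕ) (R : State) : State :=
  let newRegions : List Region := (R.drop b).mapIdx fun i r =>
    { payload := (r.payloadObjs ++
        (evacuated order b R).filter fun o => sizeClass o.size = b + i).map Slot.obj
      buffer := [] }
  (R.take b ++ newRegions).rdropWhile fun r => r.payload.isEmpty

/-- The actions of a flush of all classes `≥ b`.  Here `R` is the data structure at the start of
the flush, with a flush-triggering insertion appended to the last buffer; `w` is the size of the
inserted object (`0` if the flush is triggered by a deletion), and `Δ` is the length of the longest
active object. -/
noncomputable def flushActions (ε : ℝ) (order : List Obj → List Obj) (b : ℕ) (R : State)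
    (w Δ : ℕ) : List Action :=
  let R' := flushed order b R
  let L := contentEnd ε R - w
  let L' := space ε R' - w
  let B := ((R.drop b).map (Region.capacity ε)).sum
  let M := max L L' + B + Δ
  let buffered := evacuated order b R
  let payload := (R.drop b).flatMap Region.payloadObjs
  let target := layout ε 0 R'
  -- buffered objects go behind location `M`
  (placeObjs M buffered).map .move ++ [.checkpoint] ++
  -- payload objects are packed to the right, up to location `M`, from the last to the first
  packPhases (B + Δ) 0 (placeObjs (M - volume payload) payload).reverse ++
  -- payload objects go to their final locations, from the first to the last
  unpackPhases (B + Δ) (space ε (R.take b)) (target.filter fun x => x.obj ∈ payload) ++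
  -- buffered objects go to their final locations
  (buffered.flatMap fun o => (target.filter fun x => x.obj = o).map .move) ++ [.checkpoint]

/-! ### Executions -/

/-- The contents of the array: the current copies of the objects, and the copies freed since the
last checkpoint, whose space is not available yet. -/
structure Memory where
  live : List Block
  freed : List Block

def Memory.act (m : Memory) : Action → Memory
  | .move x =>
      ⟨m.live.filter (fun y => y.obj ≠ x.obj) ++ [x],
        m.freed ++ m.live.filter (fun y => y.obj = x.obj)⟩
  | .checkpoint => ⟨m.live, []⟩

/-- A moment of an execution: the contents of the array, the end of the last segment, and the
objects that are active at this moment. -/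
structure Moment where
  memory : Memory
  segmentsEnd : ℕ
  active : List Obj

/-- The footprint: the end of the used part of the array.  All segments (with their unoccupied
cells), all objects and all copies freed since the last checkpoint count as used. -/
def Moment.footprint (m : Moment) : ℕ :=
  max m.segmentsEnd (((m.memory.live ++ m.memory.freed).map Block.endpoint).foldr max 0)

/-- The moments of a flush of the classes `≥ b` that starts with the given memory, and the moment
of its completion.  While it proceeds, the old and the new segments are both reserved and the
objects in `A` are active; at the end, those in `A'` are. -/
noncomputable def flushMoments (ε : ℝ) (order : List Obj → List Obj) (b : ℕ) (R : State)
    (w : ℕ) (start : Memory) (A A' : List Obj) : List Moment :=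
  let R' := flushed order b R
  let mems := (flushActions ε order b R w (longest A)).scanl Memory.act start
  mems.map (fun μ => ⟨μ, max (space ε R) (space ε R'), A⟩) ++
    [⟨mems.getLastD start, space ε R', A'⟩]

/-- Insertion of an object: the moments of the request, and the resulting data structure. The
object is active from the start. `A` holds the objects active before the request. -/
noncomputable def insertObj (ε : ℝ) (order : List Obj → List Obj) (R : State) (A : List Obj)
    (o : Obj) : List Moment × State :=
  let c := sizeClass o.size
  let A' := A ++ [o]
  if R.length ≤ c then
    -- the object is in a larger class than all others: new regions at the end
    let R₁ := R ++ List.replicate (c - R.length) ⟨[], []⟩ ++ [⟨[.obj o], []⟩]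
    ([⟨⟨layout ε 0 R₁, []⟩, space ε R₁, A'⟩], R₁)
  else
    match findBuffer ε R c o.size with
    | some j =>
        let R₁ := appendToBuffer j (.obj o) R
        ([⟨⟨layout ε 0 R₁, []⟩, space ε R₁, A'⟩], R₁)
    | none =>
        let R₁ := appendToBuffer (R.length - 1) (.obj o) R
        let b := boundary R₁ c
        (flushMoments ε order b R₁ o.size ⟨layout ε 0 R₁, []⟩ A' A', flushed order b R₁)

/-- Deletion of an object: the moments of the request, and the resulting data structure. The
object is active until the request is completed. -/
noncomputable def deleteObj (ε : ℝ) (order : List Obj → List Obj) (R : State) (A : List Obj)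
    (o : Obj) : List Moment × State :=
  let c := sizeClass o.size
  let A' := A.filter (fun p => p.name ≠ o.name)
  let R₁ := eraseObj o.name R
  let old := (layout ε 0 R).filter fun x => x.obj.name = o.name
  match findBuffer ε R₁ c o.size with
  | some j =>
      let R₂ := appendToBuffer j (.record o) R₁
      ([⟨⟨layout ε 0 R, []⟩, space ε R, A⟩, ⟨⟨layout ε 0 R₂, old⟩, space ε R₂, A'⟩], R₂)
  | none =>
      let b := boundary R₁ c
      (⟨⟨layout ε 0 R, []⟩, space ε R, A⟩ ::
        flushMoments ε order b R₁ 0 ⟨layout ε 0 R₁, old⟩ A A', flushed order b R₁)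

/-- Processing one request (a deletion of an object that is not there does nothing). -/
noncomputable def process (ε : ℝ) (order : List Obj → List Obj) (R : State) (A : List Obj) :
    Request → List Moment × State
  | .insert n w => insertObj ε order R A ⟨n, w⟩
  | .delete n =>
      match A.find? (fun o => o.name = n) with
      | some o => deleteObj ε order R A o
      | none => ([], R)

/-- All moments of the processing of a sequence of requests, from a given data structure and given
active objects on. -/
noncomputable def execution (ε : ℝ) (order : List Obj → List Obj) :
    State → List Obj → List Request → List Moment
  | _, _, [] => []
  | R, A, q :: qs =>
      (process ε order R A q).1 ++
        execution ε order (process ε order R A q).2 (activeStep A q) qs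

end Realloc

/-!
The footprint is compared with the total size `T` of the payload segments: all segments together
take at most `(1 + ε) T` cells. A hole in the payload segment of class `i` is paid for by a delete
record for an object of class `i` in some buffer. As the buffers hold at most `ε T` cells in total,
`T` exceeds the volume `V` of the active objects by at most `ε T`, that is, `(1 - ε) T ≤ V`. A flush
keeps the holes in the segments that it does not touch paid for, because by the choice of the
boundary class the delete records that it removes concern classes that it rebuilds.

During a flush everything stays below `M` plus the volume of the buffered objects, which is at most
`max L L' + 2 B + w + Δ`. If `T` now denotes the larger of the payload sizes before the flush,
including `w`, and after it, then this is at most `(1 + 3 ε) T + Δ`, again `(1 - ε) T ≤ V`, and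
`1 + 3 ε ≤ (1 + 8 ε) (1 - ε)` for `ε ≤ 1 / 2`.
-/

namespace Realloc

/-! ### Volumes -/

@[simp] theorem volume_nil : volume [] = 0 := rfl

@[simp] theorem volume_cons (o : Obj) (l : List Obj) : volume (o :: l) = o.size + volume l := by
  simp [volume]

@[simp] theorem volume_append (l l' : List Obj) : volume (l ++ l') = volume l + volume l' := by
  simp [volume]

theorem volume_eq_of_perm {l l' : List Obj} (h : l.Perm l') : volume l = volume l' :=
  (h.map _).sum_eq

theorem volume_le_of_sublist {l l' : List Obj} (h : l.Sublist l') : volume l ≤ volume l' :=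
  (h.map _).sum_le_sum (by simp)

theorem volume_filter_le (p : Obj → Bool) (l : List Obj) : volume (l.filter p) ≤ volume l :=
  volume_le_of_sublist List.filter_sublist

theorem size_le_volume {o : Obj} {l : List Obj} (h : o ∈ l) : o.size ≤ volume l := by
  simpa using volume_le_of_sublist (List.singleton_sublist.2 h)

theorem volume_flatMap {α : Type*} (f : α → List Obj) (l : List α) :
    volume (l.flatMap f) = (l.map fun a => volume (f a)).sum := by
  induction l with
  | nil => rfl
  | cons a l ih => simp [ih]

theorem flatMap_range_filter_perm {α : Type*} (f : α → ℕ) (l : List α) (b n : ℕ) :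
    ((List.range n).flatMap fun i => l.filter fun a => f a = b + i).Perm
      (l.filter fun a => b ≤ f a ∧ f a < b + n) := by
  induction n with
  | zero =>
    rw [List.filter_eq_nil_iff.2]
    · rfl
    · simp
  | succ n ih =>
    rw [List.range_succ, List.flatMap_append, List.flatMap_singleton]
    refine (ih.append_right _).trans
      (.trans (.of_eq ?_) (List.filter_append_perm (fun a => decide (f a < b + n)) _))
    simp only [List.filter_filter, ← Bool.decide_and, ← decide_not]
    congr! 4 <;> omega

/-! ### Slots -/

/-- The object that a delete record refers to; the counterpart of `Slot.stored` for records. -/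
def Slot.recorded : Slot → Option Obj
  | .obj _ => none
  | .hole _ => none
  | .record o => some o

@[simp] theorem slotsSize_nil : slotsSize [] = 0 := rfl

@[simp] theorem slotsSize_cons (s : Slot) (l : List Slot) :
    slotsSize (s :: l) = s.size + slotsSize l := by
  simp [slotsSize]

@[simp] theorem slotsSize_append (l l' : List Slot) :
    slotsSize (l ++ l') = slotsSize l + slotsSize l' := by
  simp [slotsSize]

@[simp] theorem slotsSize_map_obj (l : List Obj) : slotsSize (l.map Slot.obj) = volume l := by
  simp [slotsSize, volume, Function.comp_def, Slot.size]

@[simp] theorem filterMap_stored_map_obj (l : List Obj) :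
    (l.map Slot.obj).filterMap Slot.stored = l := by
  induction l with
  | nil => rfl
  | cons o l ih => simp [Slot.stored, ih]

theorem volume_stored_add_volume_recorded_le (l : List Slot) :
    volume (l.filterMap Slot.stored) + volume (l.filterMap Slot.recorded) ≤ slotsSize l := by
  induction l with
  | nil => simp
  | cons s l ih =>
    cases s <;>
      simp only [List.filterMap_cons, Slot.stored, Slot.recorded, volume_cons, slotsSize_cons,
        Slot.size] <;>
      omega

theorem Slot.subject_eq_some_iff {s : Slot} {o : Obj} :
    s.subject = some o ↔ s.stored = some o ∨ s.recorded = some o := by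
  cases s <;> simp [Slot.subject, Slot.stored, Slot.recorded]

/-! ### Contents of a data structure -/

/-- All objects stored in a region. -/
def Region.objs (r : Region) : List Obj := r.payloadObjs ++ r.bufferObjs

/-- The objects with a delete record in a region. -/
def Region.records (r : Region) : List Obj := r.buffer.filterMap Slot.recorded

theorem Region.mem_filterMap_subject {r : Region} {o : Obj} :
    o ∈ r.buffer.filterMap Slot.subject ↔ o ∈ r.bufferObjs ∨ o ∈ r.records := by
  simp only [Region.bufferObjs, Region.records, List.mem_filterMap, Slot.subject_eq_some_iff,
    and_or_left, exists_or]

/-- All objects stored in the data structure, the regions in increasing order. -/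
def storedObjs (R : State) : List Obj := R.flatMap Region.objs

/-- The objects with a delete record in some buffer. -/
def recordedObjs (R : State) : List Obj := R.flatMap Region.records

@[simp] theorem storedObjs_append (R S : State) :
    storedObjs (R ++ S) = storedObjs R ++ storedObjs S := by
  simp [storedObjs]

@[simp] theorem storedObjs_cons (r : Region) (R : State) :
    storedObjs (r :: R) = r.objs ++ storedObjs R := by
  simp [storedObjs]

@[simp] theorem recordedObjs_append (R S : State) :
    recordedObjs (R ++ S) = recordedObjs R ++ recordedObjs S := by
  simp [recordedObjs]

@[simp] theorem recordedObjs_cons (r : Region) (R : State) :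
    recordedObjs (r :: R) = r.records ++ recordedObjs R := by
  simp [recordedObjs]

theorem storedObjs_perm (R : State) :
    (storedObjs R).Perm (R.flatMap Region.payloadObjs ++ R.flatMap Region.bufferObjs) :=
  (List.flatMap_append_perm R _ _).symm

theorem payloadObjs_sublist_storedObjs {r : Region} {R : State} (hr : r ∈ R) :
    r.payloadObjs.Sublist (storedObjs R) :=
  (List.sublist_append_left _ _).trans (List.sublist_flatten_of_mem (List.mem_map_of_mem hr))

/-- Total volume of the delete records for objects of class `i`, in whichever buffers they are. -/
def recordVolume (R : State) (i : ℕ) : ℕ :=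
  volume ((recordedObjs R).filter fun o => sizeClass o.size = i)

theorem recordVolume_append (R S : State) (i : ℕ) :
    recordVolume (R ++ S) i = recordVolume R i + recordVolume S i := by
  simp [recordVolume]

theorem recordVolume_eq_zero {R : State} {i : ℕ}
    (h : ∀ o ∈ recordedObjs R, sizeClass o.size ≠ i) : recordVolume R i = 0 := by
  rw [recordVolume, List.filter_eq_nil_iff.2 (by simpa using h), volume_nil]

theorem sum_recordVolume_le (R : State) (n : ℕ) :
    ((List.range n).map (recordVolume R)).sum ≤ volume (recordedObjs R) := by
  have h := volume_eq_of_perm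
    (flatMap_range_filter_perm (fun o : Obj => sizeClass o.size) (recordedObjs R) 0 n)
  simp only [zero_add, volume_flatMap] at h
  exact h.trans_le (volume_filter_le _ _)

/-! ### Sizes of a data structure -/

/-- Total size of the payload segments, to which all other sizes are compared. -/
def totalPayload (R : State) : ℕ := (R.map Region.payloadSize).sum

/-- Total size of the buffer segments, called `B` in the description of a flush. -/
noncomputable def totalCapacity (ε : ℝ) (R : State) : ℕ := (R.map (Region.capacity ε)).sum

/-- Total size of the parts of the buffers' contents that exceed the buffers' capacities.  The
truncated subtraction makes buffers with unoccupied cells contribute `0`. -/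
noncomputable def overflow (ε : ℝ) (R : State) : ℕ :=
  (R.map fun r => r.used - r.capacity ε).sum

@[simp] theorem totalPayload_append (R S : State) :
    totalPayload (R ++ S) = totalPayload R + totalPayload S := by
  simp [totalPayload]

@[simp] theorem totalPayload_cons (r : Region) (R : State) :
    totalPayload (r :: R) = r.payloadSize + totalPayload R := by
  simp [totalPayload]

@[simp] theorem totalCapacity_cons (ε : ℝ) (r : Region) (R : State) :
    totalCapacity ε (r :: R) = r.capacity ε + totalCapacity ε R := by
  simp [totalCapacity]

@[simp] theorem space_append (ε : ℝ) (R S : State) :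
    space ε (R ++ S) = space ε R + space ε S := by
  simp [space]

@[simp] theorem space_cons (ε : ℝ) (r : Region) (R : State) :
    space ε (r :: R) = r.payloadSize + r.capacity ε + space ε R := by
  simp [space, Region.space]

@[simp] theorem overflow_append (ε : ℝ) (R S : State) :
    overflow ε (R ++ S) = overflow ε R + overflow ε S := by
  simp [overflow]

@[simp] theorem overflow_cons (ε : ℝ) (r : Region) (R : State) :
    overflow ε (r :: R) = (r.used - r.capacity ε) + overflow ε R := by
  simp [overflow]

theorem space_eq_add (ε : ℝ) (R : State) : space ε R = totalPayload R + totalCapacity ε R :=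
  List.sum_map_add

theorem totalCapacity_le_of_sublist (ε : ℝ) {R S : State} (h : S.Sublist R) :
    totalCapacity ε S ≤ totalCapacity ε R :=
  (h.map _).sum_le_sum (by simp)

theorem overflow_le_of_sublist (ε : ℝ) {R S : State} (h : S.Sublist R) :
    overflow ε S ≤ overflow ε R :=
  (h.map _).sum_le_sum (by simp)

theorem used_le_capacity_add_overflow (ε : ℝ) {R : State} {r : Region} (hr : r ∈ R) :
    r.used ≤ r.capacity ε + overflow ε R :=
  tsub_le_iff_left.1 (List.single_le_sum (by simp) _ (List.mem_map_of_mem hr))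

theorem totalCapacity_le {ε : ℝ} (hε : 0 ≤ ε) (R : State) :
    (totalCapacity ε R : ℝ) ≤ ε * totalPayload R := by
  induction R with
  | nil => simp [totalPayload, totalCapacity]
  | cons r R ih =>
    have hr : (r.capacity ε : ℝ) ≤ ε * r.payloadSize := Nat.floor_le (by positivity)
    rw [totalCapacity_cons, totalPayload_cons, Nat.cast_add, Nat.cast_add]
    linarith

theorem space_le {ε : ℝ} (hε : 0 ≤ ε) (R : State) :
    (space ε R : ℝ) ≤ (1 + ε) * totalPayload R := by
  have := totalCapacity_le hε R
  rw [space_eq_add, Nat.cast_add]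
  linarith

theorem volume_bufferObjs_add_volume_recordedObjs_le (ε : ℝ) (R : State) :
    volume (R.flatMap Region.bufferObjs) + volume (recordedObjs R) ≤
      totalCapacity ε R + overflow ε R := by
  induction R with
  | nil => simp [recordedObjs]
  | cons r R ih =>
    have hr : volume r.bufferObjs + volume r.records ≤ r.used :=
      volume_stored_add_volume_recorded_le r.buffer
    simp only [List.flatMap_cons, recordedObjs_cons, volume_append, totalCapacity_cons,
      overflow_cons]
    omega

theorem volume_payloadObjs_le (r : Region) : volume r.payloadObjs ≤ r.payloadSize :=
  le_of_add_le_left (volume_stored_add_volume_recorded_le r.payload)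

theorem volume_flatMap_payloadObjs_drop_le (R : State) (b : ℕ) :
    volume ((R.drop b).flatMap Region.payloadObjs) ≤ totalPayload R := by
  rw [volume_flatMap]
  exact (List.sum_le_sum fun r _ => volume_payloadObjs_le r).trans
    (((List.drop_sublist b R).map _).sum_le_sum (by simp))

/-! ### The invariant -/

/-- What holds for the active objects of an admissible sequence of requests. -/
structure WellFormed (A : List Obj) : Prop where
  nodup_name : (A.map Obj.name).Nodup
  size_pos : ∀ o ∈ A, 1 ≤ o.size

theorem WellFormed.sublist {A B : List Obj} (h : WellFormed A) (hBA : B.Sublist A) :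
    WellFormed B :=
  ⟨h.nodup_name.sublist (hBA.map _), fun o ho => h.size_pos o (hBA.subset ho)⟩

theorem WellFormed.perm {A B : List Obj} (h : WellFormed A) (hAB : A.Perm B) : WellFormed B :=
  ⟨(hAB.map _).nodup_iff.1 h.nodup_name, fun o ho => h.size_pos o (hAB.symm.subset ho)⟩

theorem WellFormed.append_singleton {A : List Obj} {o : Obj} (h : WellFormed A)
    (hsize : 1 ≤ o.size) (hname : ∀ p ∈ A, p.name ≠ o.name) : WellFormed (A ++ [o]) where
  nodup_name := by
    rw [List.map_append, List.nodup_append]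
    exact ⟨h.nodup_name, by simp, by simpa using hname⟩
  size_pos := by
    simpa only [List.mem_append, List.mem_singleton, or_imp, forall_and, forall_eq]
      using ⟨h.size_pos, hsize⟩

/-- The data structure stores exactly the objects `A`; objects in a payload segment belong to the
class of its region, and the subjects of a buffer to that class or a smaller one. -/
structure Stores (A : List Obj) (R : State) : Prop where
  perm : (storedObjs R).Perm A
  payload_class : ∀ i r, R[i]? = some r → ∀ o ∈ r.payloadObjs, sizeClass o.size = i
  buffer_class : ∀ i r, R[i]? = some r →
    ∀ o ∈ r.buffer.filterMap Slot.subject, sizeClass o.size ≤ i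

/-- The holes in the payload segment of class `i` take no more space than the delete records for
objects of class `i`. -/
def HolesRecorded (R : State) (i : ℕ) : Prop :=
  ∀ r, R[i]? = some r → r.payloadSize ≤ volume r.payloadObjs + recordVolume R i

/-- The invariant between requests, `A` being the active objects. -/
structure Inv (ε : ℝ) (A : List Obj) (R : State) : Prop where
  wellFormed : WellFormed A
  stores : Stores A R
  fits : overflow ε R = 0
  recorded : ∀ i, HolesRecorded R i

theorem inv_nil (ε : ℝ) : Inv ε [] [] where
  wellFormed := ⟨List.nodup_nil, by simp⟩
  stores := ⟨.nil, by simp, by simp⟩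
  fits := rfl
  recorded i r hr := by simp at hr

theorem Inv.perm {ε : ℝ} {A B : List Obj} {R : State} (h : Inv ε A R) (hAB : A.Perm B) :
    Inv ε B R where
  wellFormed := h.wellFormed.perm hAB
  stores := ⟨h.stores.perm.trans hAB, h.stores.payload_class, h.stores.buffer_class⟩
  fits := h.fits
  recorded := h.recorded

theorem totalPayload_le_of_holesRecorded {R : State} (h : ∀ i, HolesRecorded R i) :
    totalPayload R ≤ volume (R.flatMap Region.payloadObjs) + volume (recordedObjs R) :=
  calc
    totalPayload R = (R.zipIdx.map fun x => x.1.payloadSize).sum := by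
      conv_lhs => rw [totalPayload, ← List.zipIdx_map_fst 0 R, List.map_map]
      rfl
    _ ≤ (R.zipIdx.map fun x => volume x.1.payloadObjs + recordVolume R x.2).sum :=
      List.sum_le_sum fun x hx => h x.2 x.1 (List.mem_zipIdx_iff_getElem?.1 hx)
    _ = volume (R.flatMap Region.payloadObjs) +
        ((List.range R.length).map (recordVolume R)).sum := by
      rw [List.sum_map_add, volume_flatMap, List.range_eq_range', ← List.zipIdx_map_snd 0 R,
        List.map_map]
      conv_rhs => rw [← List.zipIdx_map_fst 0 R, List.map_map]
      simp only [List.zipIdx_map_fst, Function.comp_def]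
    _ ≤ _ := Nat.add_le_add_left (sum_recordVolume_le R _) _

theorem Inv.totalPayload_le {ε : ℝ} (hε : 0 ≤ ε) {A : List Obj} {R : State} (h : Inv ε A R) :
    (1 - ε) * totalPayload R ≤ volume A := by
  have hpayload := totalPayload_le_of_holesRecorded h.recorded
  have hbuffer := volume_bufferObjs_add_volume_recordedObjs_le ε R
  have hstored := volume_eq_of_perm ((storedObjs_perm R).symm.trans h.stores.perm)
  rw [volume_append] at hstored
  have htotal : (totalPayload R : ℝ) ≤ volume A + totalCapacity ε R := by
    have := h.fits
    exact_mod_cast (by omega : totalPayload R ≤ volume A + totalCapacity ε R)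
  linarith [totalCapacity_le hε R]

/-! ### Buffering a request -/

theorem exists_appendToBuffer_eq {j : ℕ} {R : State} (hj : j < R.length) (s : Slot) :
    ∃ R₁ r R₂, R = R₁ ++ r :: R₂ ∧ R₁.length = j ∧
      appendToBuffer j s R = R₁ ++ ⟨r.payload, r.buffer ++ [s]⟩ :: R₂ :=
  List.exists_of_modify _ hj

theorem getElem?_appendToBuffer {R : State} {j i : ℕ} {s : Slot} {r : Region}
    (h : (appendToBuffer j s R)[i]? = some r) :
    ∃ r₀, R[i]? = some r₀ ∧ r.payload = r₀.payload ∧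
      r.buffer = r₀.buffer ++ if j = i then [s] else [] := by
  simp only [appendToBuffer, List.getElem?_modify, Option.map_eq_map, Option.map_eq_some_iff] at h
  obtain ⟨r₀, h₀, rfl⟩ := h
  refine ⟨r₀, h₀, ?_⟩
  split_ifs <;> simp

theorem take_appendToBuffer {b j : ℕ} (h : b ≤ j) (s : Slot) (R : State) :
    (appendToBuffer j s R).take b = R.take b := by
  rw [appendToBuffer, List.take_modify, List.modify_eq_self (by grind)]

section appendToBuffer

variable {j : ℕ} {R : State} (hj : j < R.length) (s : Slot)
include hj

theorem totalPayload_appendToBuffer : totalPayload (appendToBuffer j s R) = totalPayload R := by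
  obtain ⟨R₁, r, R₂, rfl, -, h⟩ := exists_appendToBuffer_eq hj s
  simp [h, Region.payloadSize]

theorem space_appendToBuffer (ε : ℝ) : space ε (appendToBuffer j s R) = space ε R := by
  obtain ⟨R₁, r, R₂, rfl, -, h⟩ := exists_appendToBuffer_eq hj s
  simp [h, Region.payloadSize, Region.capacity]

theorem overflow_appendToBuffer_le (ε : ℝ) :
    overflow ε (appendToBuffer j s R) ≤ overflow ε R + s.size := by
  obtain ⟨R₁, r, R₂, rfl, -, h⟩ := exists_appendToBuffer_eq hj s
  simp only [h, overflow_append, overflow_cons, Region.used, slotsSize_append, slotsSize_cons,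
    slotsSize_nil, Region.capacity, Region.payloadSize]
  omega

theorem storedObjs_appendToBuffer_perm :
    (storedObjs (appendToBuffer j s R)).Perm (storedObjs R ++ s.stored.toList) := by
  obtain ⟨R₁, r, R₂, rfl, -, h⟩ := exists_appendToBuffer_eq hj s
  have hr : Region.objs ⟨r.payload, r.buffer ++ [s]⟩ = r.objs ++ s.stored.toList := by
    cases s <;> simp [Region.objs, Region.payloadObjs, Region.bufferObjs, Slot.stored]
  simp only [h, hr, storedObjs_append, storedObjs_cons, List.append_assoc]
  exact (List.perm_append_comm.append_left _).append_left _

theorem recordedObjs_appendToBuffer_perm :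
    (recordedObjs (appendToBuffer j s R)).Perm (recordedObjs R ++ s.recorded.toList) := by
  obtain ⟨R₁, r, R₂, rfl, -, h⟩ := exists_appendToBuffer_eq hj s
  have hr : Region.records ⟨r.payload, r.buffer ++ [s]⟩ = r.records ++ s.recorded.toList := by
    cases s <;> simp [Region.records, Slot.recorded]
  simp only [h, hr, recordedObjs_append, recordedObjs_cons, List.append_assoc]
  exact (List.perm_append_comm.append_left _).append_left _

theorem recordVolume_appendToBuffer (i : ℕ) :
    recordVolume (appendToBuffer j s R) i =
      recordVolume R i + volume (s.recorded.toList.filter fun o => sizeClass o.size = i) := by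
  rw [recordVolume, volume_eq_of_perm ((recordedObjs_appendToBuffer_perm hj s).filter _),
    List.filter_append, volume_append, recordVolume]

end appendToBuffer

theorem overflow_appendToBuffer_of_fits {ε : ℝ} {j : ℕ} {R : State} {s : Slot} {r : Region}
    (hr : R[j]? = some r) (hfits : r.used + s.size ≤ r.capacity ε) :
    overflow ε (appendToBuffer j s R) = overflow ε R := by
  obtain ⟨R₁, r', R₂, rfl, rfl, h⟩ :=
    exists_appendToBuffer_eq (List.getElem?_eq_some_iff.1 hr).1 s
  obtain rfl : r' = r := by simpa using hr
  simp only [h, overflow_append, overflow_cons]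
  simp only [Region.used, slotsSize_append, slotsSize_cons, slotsSize_nil, Region.capacity,
    Region.payloadSize] at hfits ⊢
  omega

protected theorem Stores.appendToBuffer {A : List Obj} {R : State} (h : Stores A R) {j : ℕ}
    (hj : j < R.length) {s : Slot} (hs : ∀ o ∈ s.subject, sizeClass o.size ≤ j) :
    Stores (A ++ s.stored.toList) (appendToBuffer j s R) where
  perm := (storedObjs_appendToBuffer_perm hj s).trans (h.perm.append_right _)
  payload_class i r hr := by
    obtain ⟨r₀, h₀, hpayload, -⟩ := getElem?_appendToBuffer hr
    simpa [Region.payloadObjs, hpayload] using h.payload_class i r₀ h₀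
  buffer_class i r hr o ho := by
    obtain ⟨r₀, h₀, -, hbuffer⟩ := getElem?_appendToBuffer hr
    rw [hbuffer, List.filterMap_append, List.mem_append] at ho
    rcases ho with ho | ho
    · exact h.buffer_class i r₀ h₀ o ho
    · split_ifs at ho with hji
      · exact hji ▸ hs o (by simpa using ho)
      · simp at ho

protected theorem HolesRecorded.appendToBuffer {R : State} {i j : ℕ} (h : HolesRecorded R i)
    (hj : j < R.length) (s : Slot) : HolesRecorded (appendToBuffer j s R) i := by
  intro r hr
  obtain ⟨r₀, h₀, hpayload, -⟩ := getElem?_appendToBuffer hr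
  rw [recordVolume_appendToBuffer hj, Region.payloadSize, Region.payloadObjs, hpayload,
    ← add_assoc]
  exact le_add_right (h r₀ h₀)

theorem findBuffer_eq_some {ε : ℝ} {R : State} {c w j : ℕ} (h : findBuffer ε R c w = some j) :
    c ≤ j ∧ ∃ r, R[j]? = some r ∧ r.used + w ≤ r.capacity ε := by
  simpa using List.find?_some h

theorem Inv.appendToBuffer_obj {ε : ℝ} {A : List Obj} {R : State} (h : Inv ε A R) {o : Obj}
    (hwf : WellFormed (A ++ [o])) {j : ℕ}
    (hj : findBuffer ε R (sizeClass o.size) o.size = some j) :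
    Inv ε (A ++ [o]) (appendToBuffer j (.obj o) R) := by
  obtain ⟨hc, r, hr, hfits⟩ := findBuffer_eq_some hj
  have hlt := (List.getElem?_eq_some_iff.1 hr).1
  exact
    { wellFormed := hwf
      stores := h.stores.appendToBuffer (s := .obj o) hlt (by simpa [Slot.subject] using hc)
      fits := (overflow_appendToBuffer_of_fits (s := .obj o) hr hfits).trans h.fits
      recorded := fun i => (h.recorded i).appendToBuffer hlt _ }

/-! ### Erasing an object -/

@[simp] theorem Slot.size_erase (n : ℕ) (s : Slot) : (s.erase n).size = s.size := by
  cases s with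
  | obj o => by_cases h : o.name = n <;> simp [Slot.erase, h, Slot.size]
  | hole w => rfl
  | record o => rfl

theorem Slot.stored_erase (n : ℕ) (s : Slot) :
    (s.erase n).stored = s.stored.filter fun o => o.name ≠ n := by
  cases s with
  | obj o => by_cases h : o.name = n <;> simp [Slot.erase, h, Slot.stored, Option.filter]
  | hole w => rfl
  | record o => rfl

theorem Slot.recorded_erase (n : ℕ) (s : Slot) : (s.erase n).recorded = s.recorded := by
  cases s with
  | obj o => by_cases h : o.name = n <;> simp [Slot.erase, h, Slot.recorded]
  | hole w => rfl
  | record o => rfl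

@[simp] theorem slotsSize_map_erase (n : ℕ) (l : List Slot) :
    slotsSize (l.map (Slot.erase n)) = slotsSize l := by
  simp [slotsSize, Function.comp_def]

theorem filterMap_stored_map_erase (n : ℕ) (l : List Slot) :
    (l.map (Slot.erase n)).filterMap Slot.stored =
      (l.filterMap Slot.stored).filter fun o => o.name ≠ n := by
  rw [List.filterMap_map, List.filter_filterMap]
  congr 1
  ext1 s
  exact Slot.stored_erase n s

theorem filterMap_recorded_map_erase (n : ℕ) (l : List Slot) :
    (l.map (Slot.erase n)).filterMap Slot.recorded = l.filterMap Slot.recorded := by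
  rw [List.filterMap_map]
  congr 1
  ext1 s
  exact Slot.recorded_erase n s

/-- Replace the object of the given name by a hole; the effect of `eraseObj` on one region. -/
def Region.erase (n : ℕ) (r : Region) : Region :=
  ⟨r.payload.map (Slot.erase n), r.buffer.map (Slot.erase n)⟩

@[simp] theorem Region.payloadSize_erase (n : ℕ) (r : Region) :
    (r.erase n).payloadSize = r.payloadSize :=
  slotsSize_map_erase n r.payload

@[simp] theorem Region.capacity_erase (ε : ℝ) (n : ℕ) (r : Region) :
    (r.erase n).capacity ε = r.capacity ε := by
  simp [Region.capacity]

theorem Region.space_erase (ε : ℝ) (n : ℕ) (r : Region) :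
    (r.erase n).space ε = r.space ε := by
  simp [Region.space]

@[simp] theorem Region.used_erase (n : ℕ) (r : Region) : (r.erase n).used = r.used :=
  slotsSize_map_erase n r.buffer

theorem Region.payloadObjs_erase (n : ℕ) (r : Region) :
    (r.erase n).payloadObjs = r.payloadObjs.filter fun o => o.name ≠ n :=
  filterMap_stored_map_erase n r.payload

theorem Region.bufferObjs_erase (n : ℕ) (r : Region) :
    (r.erase n).bufferObjs = r.bufferObjs.filter fun o => o.name ≠ n :=
  filterMap_stored_map_erase n r.buffer

theorem Region.records_erase (n : ℕ) (r : Region) : (r.erase n).records = r.records :=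
  filterMap_recorded_map_erase n r.buffer

theorem eraseObj_eq_map (n : ℕ) (R : State) : eraseObj n R = R.map (Region.erase n) := rfl

@[simp] theorem length_eraseObj (n : ℕ) (R : State) : (eraseObj n R).length = R.length := by
  simp [eraseObj_eq_map]

theorem totalPayload_eraseObj (n : ℕ) (R : State) :
    totalPayload (eraseObj n R) = totalPayload R := by
  simp [totalPayload, eraseObj_eq_map, Function.comp_def]

theorem space_eraseObj (ε : ℝ) (n : ℕ) (R : State) : space ε (eraseObj n R) = space ε R := by
  simp [space, eraseObj_eq_map, Function.comp_def, funext (Region.space_erase ε n)]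

theorem overflow_eraseObj (ε : ℝ) (n : ℕ) (R : State) :
    overflow ε (eraseObj n R) = overflow ε R := by
  simp [overflow, eraseObj_eq_map, Function.comp_def]

theorem storedObjs_eraseObj (n : ℕ) (R : State) :
    storedObjs (eraseObj n R) = (storedObjs R).filter fun o => o.name ≠ n := by
  simp only [storedObjs, eraseObj_eq_map, List.flatMap_map, Region.objs,
    Region.payloadObjs_erase, Region.bufferObjs_erase, List.filter_flatMap, List.filter_append]

theorem recordVolume_eraseObj (n : ℕ) (R : State) (i : ℕ) :
    recordVolume (eraseObj n R) i = recordVolume R i := by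
  simp only [recordVolume, recordedObjs, eraseObj_eq_map, List.flatMap_map, Region.records_erase]

theorem getElem?_eraseObj {n : ℕ} {R : State} {i : ℕ} {r : Region}
    (h : (eraseObj n R)[i]? = some r) : ∃ r₀, R[i]? = some r₀ ∧ r₀.erase n = r := by
  simpa [eraseObj_eq_map] using h

protected theorem Stores.eraseObj {A : List Obj} {R : State} (h : Stores A R) (n : ℕ) :
    Stores (A.filter fun o => o.name ≠ n) (eraseObj n R) where
  perm := by
    rw [storedObjs_eraseObj]
    exact h.perm.filter _
  payload_class i r hr o ho := by
    obtain ⟨r₀, h₀, rfl⟩ := getElem?_eraseObj hr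
    rw [Region.payloadObjs_erase] at ho
    exact h.payload_class i r₀ h₀ o (List.mem_of_mem_filter ho)
  buffer_class i r hr o ho := by
    obtain ⟨r₀, h₀, rfl⟩ := getElem?_eraseObj hr
    refine h.buffer_class i r₀ h₀ o ?_
    rw [Region.mem_filterMap_subject, Region.bufferObjs_erase, Region.records_erase] at ho
    exact Region.mem_filterMap_subject.2 (ho.imp_left List.mem_of_mem_filter)

theorem filter_name_eq {A : List Obj} (hA : (A.map Obj.name).Nodup) {o : Obj} (ho : o ∈ A) :
    (A.filter fun p => p.name = o.name) = [o] := by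
  have hname : ∀ p ∈ A, p.name = o.name ↔ p = o := fun p hp =>
    ⟨List.inj_on_of_nodup_map hA hp ho, congrArg _⟩
  rw [List.filter_congr fun p hp => decide_eq_decide.2 (hname p hp), List.filter_eq,
    List.count_eq_one_of_mem hA.of_map ho, List.replicate_one]

section eraseObj

variable {A : List Obj} {R : State} {o : Obj}

theorem Stores.volume_payloadObjs_le_erase (h : Stores A R) (hA : WellFormed A) (ho : o ∈ A)
    {i : ℕ} {r : Region} (hr : R[i]? = some r) :
    volume r.payloadObjs ≤
      volume (r.erase o.name).payloadObjs + if sizeClass o.size = i then o.size else 0 := by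
  rw [Region.payloadObjs_erase]
  have hsub := payloadObjs_sublist_storedObjs (List.mem_of_getElem? hr)
  have hfilter := (h.perm.filter fun p => p.name = o.name).trans
    (.of_eq (filter_name_eq hA.nodup_name ho))
  split_ifs with hc
  · have herased := volume_le_of_sublist (hsub.filter fun p => p.name = o.name)
    have hsplit := volume_eq_of_perm
      (List.filter_append_perm (fun p : Obj => decide (p.name = o.name)) r.payloadObjs)
    rw [volume_eq_of_perm hfilter, volume_cons, volume_nil] at herased
    simp only [volume_append, ← decide_not, ← ne_eq] at hsplit
    omega
  · rw [List.filter_eq_self.2, add_zero]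
    intro p hp
    rw [decide_eq_true_eq]
    intro hname
    obtain rfl : p = o := by
      simpa using hfilter.subset (List.mem_filter.2 ⟨hsub.subset hp, by simpa using hname⟩)
    exact hc (h.payload_class i r hr p hp)

theorem HolesRecorded.payloadSize_erase_le {i : ℕ} (hrec : HolesRecorded R i) (h : Stores A R)
    (hA : WellFormed A) (ho : o ∈ A) {r : Region} (hr : (eraseObj o.name R)[i]? = some r) :
    r.payloadSize ≤ volume r.payloadObjs + recordVolume R i +
      if sizeClass o.size = i then o.size else 0 := by
  obtain ⟨r₀, h₀, rfl⟩ := getElem?_eraseObj hr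
  have := hrec r₀ h₀
  have := h.volume_payloadObjs_le_erase hA ho h₀
  rw [Region.payloadSize_erase]
  omega

protected theorem HolesRecorded.eraseObj {i : ℕ} (hrec : HolesRecorded R i) (h : Stores A R)
    (hA : WellFormed A) (ho : o ∈ A) (hi : sizeClass o.size ≠ i) :
    HolesRecorded (eraseObj o.name R) i := by
  intro r hr
  simpa [recordVolume_eraseObj, hi] using hrec.payloadSize_erase_le h hA ho hr

theorem HolesRecorded.eraseObj_appendToBuffer_record {i j : ℕ} (hrec : HolesRecorded R i)
    (h : Stores A R) (hA : WellFormed A) (ho : o ∈ A) (hj : j < R.length) :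
    HolesRecorded (appendToBuffer j (.record o) (eraseObj o.name R)) i := by
  intro r hr
  obtain ⟨r₀, h₀, hpayload, -⟩ := getElem?_appendToBuffer hr
  have hle := hrec.payloadSize_erase_le h hA ho h₀
  rw [recordVolume_appendToBuffer (by simpa using hj), recordVolume_eraseObj, Region.payloadSize,
    Region.payloadObjs, hpayload, ← add_assoc]
  refine hle.trans (Nat.add_le_add_left ?_ _)
  split_ifs with hc <;> simp [Slot.recorded, hc]

theorem Inv.eraseObj_appendToBuffer_record {ε : ℝ} (h : Inv ε A R) (ho : o ∈ A) {j : ℕ}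
    (hj : findBuffer ε (eraseObj o.name R) (sizeClass o.size) o.size = some j) :
    Inv ε (A.filter fun p => p.name ≠ o.name)
      (appendToBuffer j (.record o) (eraseObj o.name R)) := by
  obtain ⟨hc, r, hr, hfits⟩ := findBuffer_eq_some hj
  have hlt := (List.getElem?_eq_some_iff.1 hr).1
  have hstores := (h.stores.eraseObj o.name).appendToBuffer (s := .record o) hlt
    (by simpa [Slot.subject] using hc)
  exact
    { wellFormed := h.wellFormed.sublist List.filter_sublist
      stores := by simpa [Slot.stored] using hstores
      fits := by
        rw [overflow_appendToBuffer_of_fits (s := .record o) hr hfits, overflow_eraseObj, h.fits]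
      recorded := fun i => (h.recorded i).eraseObj_appendToBuffer_record h.stores h.wellFormed ho
        (by simpa using hlt) }

end eraseObj

/-! ### Creating and removing regions -/

/-- A region as a flush or the creation of a region leaves it: the payload segment consists of the
given objects, the buffer is empty. -/
def freshRegion (E : List Obj) : Region := ⟨E.map Slot.obj, []⟩

@[simp] theorem payloadSize_freshRegion (E : List Obj) :
    (freshRegion E).payloadSize = volume E :=
  slotsSize_map_obj E

@[simp] theorem payloadObjs_freshRegion (E : List Obj) : (freshRegion E).payloadObjs = E :=
  filterMap_stored_map_obj E

@[simp] theorem objs_freshRegion (E : List Obj) : (freshRegion E).objs = E := by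
  rw [Region.objs, payloadObjs_freshRegion]
  exact List.append_nil E

theorem storedObjs_map_freshRegion (Es : List (List Obj)) :
    storedObjs (Es.map freshRegion) = Es.flatten := by
  simp [storedObjs, List.flatMap_map]

theorem overflow_map_freshRegion (ε : ℝ) (Es : List (List Obj)) :
    overflow ε (Es.map freshRegion) = 0 := by
  simp [overflow, Function.comp_def, freshRegion, Region.used, slotsSize]

theorem getElem?_append_map_freshRegion {S : State} {Es : List (List Obj)} {i : ℕ} {r : Region}
    (h : (S ++ Es.map freshRegion)[i]? = some r) :
    S[i]? = some r ∨ ∃ k E, i = S.length + k ∧ Es[k]? = some E ∧ freshRegion E = r := by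
  rcases lt_or_ge i S.length with hi | hi
  · rw [List.getElem?_append_left hi] at h
    exact Or.inl h
  · rw [List.getElem?_append_right hi, List.getElem?_map, Option.map_eq_some_iff] at h
    obtain ⟨E, hE, rfl⟩ := h
    exact Or.inr ⟨i - S.length, E, by omega, hE, rfl⟩

theorem Inv.append_freshRegions {ε : ℝ} {A : List Obj} {S : State} (h : Inv ε A S)
    {Es : List (List Obj)} (hwf : WellFormed (A ++ Es.flatten))
    (hclass : ∀ k E, Es[k]? = some E → ∀ o ∈ E, sizeClass o.size = S.length + k) :
    Inv ε (A ++ Es.flatten) (S ++ Es.map freshRegion) where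
  wellFormed := hwf
  stores.perm := by
    rw [storedObjs_append, storedObjs_map_freshRegion]
    exact h.stores.perm.append_right _
  stores.payload_class i r hr := by
    rcases getElem?_append_map_freshRegion hr with hr | ⟨k, E, rfl, hE, rfl⟩
    · exact h.stores.payload_class i r hr
    · simpa using hclass k E hE
  stores.buffer_class i r hr := by
    rcases getElem?_append_map_freshRegion hr with hr | ⟨k, E, -, -, rfl⟩
    · exact h.stores.buffer_class i r hr
    · exact fun o ho => absurd ho List.not_mem_nil
  fits := by rw [overflow_append, h.fits, overflow_map_freshRegion]
  recorded i r hr := by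
    rcases getElem?_append_map_freshRegion hr with hr | ⟨k, E, -, -, rfl⟩
    · have := h.recorded i r hr
      rw [recordVolume_append]
      omega
    · simp

theorem Inv.append_newRegion {ε : ℝ} {A : List Obj} {R : State} (h : Inv ε A R) {o : Obj}
    (hwf : WellFormed (A ++ [o])) (hc : R.length ≤ sizeClass o.size) :
    Inv ε (A ++ [o]) (R ++ List.replicate (sizeClass o.size - R.length) ⟨[], []⟩ ++
      [⟨[.obj o], []⟩]) := by
  have hnew := h.append_freshRegions
    (Es := List.replicate (sizeClass o.size - R.length) [] ++ [[o]]) (by simpa using hwf)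
  simp only [List.flatten_append, List.flatten_replicate_nil, List.flatten_singleton,
    List.nil_append, List.map_append, List.map_replicate, ← List.append_assoc] at hnew
  refine hnew fun k E hE p hp => ?_
  rw [List.getElem?_append] at hE
  split_ifs at hE with hk
  · simp_all
  · rw [List.getElem?_singleton] at hE
    split_ifs at hE with hk'
    obtain rfl := Option.some.inj hE
    obtain rfl := List.mem_singleton.1 hp
    rw [List.length_replicate] at hk hk'
    omega

theorem Inv.dropLast {ε : ℝ} {A : List Obj} {R : State} {r : Region}
    (h : Inv ε A (R ++ [r])) (hr : r.payload = []) : Inv ε A R := by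
  have hvolume : volume r.bufferObjs + volume r.records = 0 := by
    have hmem : r ∈ R ++ [r] := by simp
    have hused := used_le_capacity_add_overflow ε hmem
    rw [h.fits, Region.capacity, Region.payloadSize, hr, slotsSize_nil, Nat.cast_zero, mul_zero,
      Nat.floor_zero] at hused
    exact Nat.le_zero.1 ((volume_stored_add_volume_recorded_le r.buffer).trans hused)
  have hpayload : r.payloadObjs = [] := by simp [Region.payloadObjs, hr]
  have hobjs : r.objs = [] := by
    rw [Region.objs, hpayload, List.nil_append, List.eq_nil_iff_forall_not_mem]
    intro o ho
    have hpos := h.wellFormed.size_pos o (h.stores.perm.subset (by simp [Region.objs, ho]))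
    have := size_le_volume ho
    omega
  have hrecords (i) : recordVolume (R ++ [r]) i = recordVolume R i := by
    have := volume_filter_le (fun o => sizeClass o.size = i) r.records
    have hr : recordVolume [r] i = 0 := by
      rw [recordVolume, recordedObjs, List.flatMap_singleton]
      omega
    rw [recordVolume_append, hr, add_zero]
  have hget {i : ℕ} {s : Region} (hs : R[i]? = some s) : (R ++ [r])[i]? = some s := by
    rw [List.getElem?_append_left (List.getElem?_eq_some_iff.1 hs).1, hs]
  exact
    { wellFormed := h.wellFormed
      stores.perm := by simpa [storedObjs, hobjs] using h.stores.perm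
      stores.payload_class := fun i s hs => h.stores.payload_class i s (hget hs)
      stores.buffer_class := fun i s hs => h.stores.buffer_class i s (hget hs)
      fits := by
        have := h.fits
        rw [overflow_append] at this
        omega
      recorded := fun i s hs => hrecords i ▸ h.recorded i s (hget hs) }

theorem Inv.rdropWhile {ε : ℝ} {A : List Obj} {R : State} (h : Inv ε A R) :
    Inv ε A (R.rdropWhile fun r => r.payload.isEmpty) := by
  induction R using List.reverseRecOn with
  | nil => exact h
  | append_singleton R r ih =>
    rw [List.rdropWhile_concat]
    split_ifs with hr
    · exact ih (h.dropLast (by simpa using hr))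
    · exact h

theorem space_rdropWhile (ε : ℝ) (R : State) :
    space ε (R.rdropWhile fun r => r.payload.isEmpty) = space ε R := by
  induction R using List.reverseRecOn with
  | nil => rfl
  | append_singleton R r ih =>
    rw [List.rdropWhile_concat]
    split_ifs with hr
    · have hsize : r.payloadSize = 0 := by simp_all [Region.payloadSize]
      rw [ih, space_append]
      simp [space, Region.space, Region.capacity, hsize]
    · rfl

/-! ### The data structure after a flush -/

/-- The condition defining the boundary class of a flush, without that on the triggering object:
all subjects of the buffers `i ≥ b` belong to classes `≥ b`. -/
def IsFlushBoundary (b : ℕ) (R : State) : Prop :=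
  ∀ r ∈ R.drop b, ∀ o ∈ r.buffer.filterMap Slot.subject, b ≤ sizeClass o.size

theorem boundary_le (R : State) (c : ℕ) : boundary R c ≤ c := Nat.findGreatest_le _

theorem isFlushBoundary_boundary (R : State) (c : ℕ) : IsFlushBoundary (boundary R c) R :=
  Nat.findGreatest_spec
    (P := fun b => ∀ r ∈ R.drop b, ∀ o ∈ r.buffer.filterMap Slot.subject, b ≤ sizeClass o.size)
    (Nat.zero_le c) fun _ _ _ _ => Nat.zero_le _

theorem IsFlushBoundary.recordVolume_drop {b : ℕ} {R : State} (h : IsFlushBoundary b R) {i : ℕ}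
    (hi : i < b) : recordVolume (R.drop b) i = 0 := by
  refine recordVolume_eq_zero fun o ho => ?_
  obtain ⟨r, hr, ho⟩ := List.mem_flatMap.1 ho
  exact (hi.trans_le (h r hr o (Region.mem_filterMap_subject.2 (Or.inr ho)))).ne'

/-- What a flush of the classes `≥ b` relies on: the invariant, except that the buffers to be
flushed may be overfull and holes of the classes to be flushed need no delete records. -/
structure FlushReady (ε : ℝ) (b : ℕ) (A : List Obj) (R : State) : Prop where
  wellFormed : WellFormed A
  stores : Stores A R
  isFlushBoundary : IsFlushBoundary b R
  fits_take : overflow ε (R.take b) = 0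
  recorded : ∀ i < b, HolesRecorded R i

theorem FlushReady.inv_take {ε : ℝ} {b : ℕ} {A : List Obj} {R : State}
    (h : FlushReady ε b A R) : Inv ε (storedObjs (R.take b)) (R.take b) := by
  have hget {i r} (hr : (R.take b)[i]? = some r) : i < b ∧ R[i]? = some r := by
    simpa [List.getElem?_take] using hr
  have hsub : (storedObjs (R.take b)).Sublist (storedObjs R) := by
    conv_rhs => rw [← List.take_append_drop b R, storedObjs_append]
    exact List.sublist_append_left _ _
  exact
    { wellFormed := (h.wellFormed.perm h.stores.perm.symm).sublist hsub
      stores.perm := .refl _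
      stores.payload_class := fun i r hr => h.stores.payload_class i r (hget hr).2
      stores.buffer_class := fun i r hr => h.stores.buffer_class i r (hget hr).2
      fits := h.fits_take
      recorded := fun i r hr => by
        obtain ⟨hi, hr⟩ := hget hr
        have hrec := h.recorded i hi r hr
        rwa [← List.take_append_drop b R, recordVolume_append,
          h.isFlushBoundary.recordVolume_drop hi] at hrec }

/-- The contents of the payload segments of the classes `b, b + 1, …` after a flush that puts the
objects `E` behind those already in the payload segments of the regions `D`. -/
def rebuiltPayloads (E : List Obj) (b : ℕ) (D : State) : List (List Obj) :=
  D.mapIdx fun i r => r.payloadObjs ++ E.filter fun o => sizeClass o.size = b + i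

theorem flushed_eq (order : List Obj → List Obj) (b : ℕ) (R : State) :
    flushed order b R = (R.take b ++
      (rebuiltPayloads (evacuated order b R) b (R.drop b)).map freshRegion).rdropWhile
        fun r => r.payload.isEmpty := by
  rw [rebuiltPayloads, List.mapIdx_eq_zipIdx_map, List.map_map, flushed, List.mapIdx_eq_zipIdx_map]
  rfl

theorem flatten_rebuiltPayloads_perm (E : List Obj) (b : ℕ) (D : State) :
    (rebuiltPayloads E b D).flatten.Perm (D.flatMap Region.payloadObjs ++
      E.filter fun o => b ≤ sizeClass o.size ∧ sizeClass o.size < b + D.length) := by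
  rw [rebuiltPayloads, List.mapIdx_eq_zipIdx_map, ← List.flatMap_def]
  refine (List.flatMap_append_perm _ _ _).symm.trans (.append (.of_eq ?_) (.trans (.of_eq ?_)
    (flatMap_range_filter_perm (fun o : Obj => sizeClass o.size) E b D.length)))
  · conv_rhs => rw [← List.zipIdx_map_fst 0 D, List.flatMap_map]
  · rw [List.range_eq_range', ← List.zipIdx_map_snd 0 D, List.flatMap_map]

theorem evacuated_perm {order : List Obj → List Obj} (horder : ∀ l, (order l).Perm l) (b : ℕ)
    (R : State) : (evacuated order b R).Perm ((R.drop b).flatMap Region.bufferObjs) :=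
  horder _

theorem FlushReady.sizeClass_evacuated {ε : ℝ} {b : ℕ} {A : List Obj} {R : State}
    (h : FlushReady ε b A R) {o : Obj} (ho : o ∈ (R.drop b).flatMap Region.bufferObjs) :
    b ≤ sizeClass o.size ∧ sizeClass o.size < b + (R.drop b).length := by
  obtain ⟨r, hr, ho⟩ := List.mem_flatMap.1 ho
  have hsubject := Region.mem_filterMap_subject.2 (Or.inl ho)
  obtain ⟨i, hi⟩ := List.mem_iff_getElem?.1 hr
  have hle := h.stores.buffer_class (b + i) r (by rwa [← List.getElem?_drop]) o hsubject
  exact ⟨h.isFlushBoundary r hr o hsubject,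
    hle.trans_lt (Nat.add_lt_add_left (List.getElem?_eq_some_iff.1 hi).1 b)⟩

theorem FlushReady.inv_flushed {ε : ℝ} {b : ℕ} {A : List Obj} {R : State}
    (h : FlushReady ε b A R) {order : List Obj → List Obj} (horder : ∀ l, (order l).Perm l) :
    Inv ε A (flushed order b R) := by
  set Es := rebuiltPayloads (evacuated order b R) b (R.drop b) with hEs
  have hevac := evacuated_perm horder b R
  have hflatten : Es.flatten.Perm (storedObjs (R.drop b)) := by
    refine (flatten_rebuiltPayloads_perm _ _ _).trans (.trans ?_ (storedObjs_perm _).symm)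
    rw [List.filter_eq_self.2 fun o ho =>
      decide_eq_true (h.sizeClass_evacuated (hevac.subset ho))]
    exact hevac.append_left _
  have hperm : (storedObjs (R.take b) ++ Es.flatten).Perm A := by
    refine (hflatten.append_left _).trans ?_
    rw [← storedObjs_append, List.take_append_drop]
    exact h.stores.perm
  rw [flushed_eq]
  refine ((h.inv_take.append_freshRegions (h.wellFormed.perm hperm.symm) ?_).perm hperm).rdropWhile
  intro k E hE o ho
  rw [hEs, rebuiltPayloads, List.getElem?_mapIdx, Option.map_eq_some_iff] at hE
  obtain ⟨r, hr, rfl⟩ := hE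
  have hk := (List.getElem?_eq_some_iff.1 hr).1
  rw [List.getElem?_drop] at hr
  have hlength : (R.take b).length = b := by
    rw [List.length_drop] at hk
    rw [List.length_take]
    omega
  rw [hlength]
  rcases List.mem_append.1 ho with ho | ho
  · exact h.stores.payload_class (b + k) r hr o ho
  · simpa using (List.mem_filter.1 ho).2

theorem space_take_le_space_flushed (ε : ℝ) (order : List Obj → List Obj) (b : ℕ) (R : State) :
    space ε (R.take b) ≤ space ε (flushed order b R) := by
  rw [flushed_eq, space_rdropWhile, space_append]
  exact Nat.le_add_right _ _

/-! ### Locations of the objects -/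

theorem placeSlots_endpoint_le {a : ℕ} {l : List Slot} {y : Block} (hy : y ∈ placeSlots a l) :
    y.endpoint ≤ a + slotsSize l := by
  induction l generalizing a with
  | nil => cases hy
  | cons s l ih =>
    rw [slotsSize_cons, ← add_assoc]
    cases s with
    | obj o =>
      rcases List.mem_cons.1 hy with rfl | hy
      · exact Nat.le_add_right _ _
      · exact ih hy
    | hole w => exact ih hy
    | record o => exact ih hy

theorem map_obj_placeSlots (a : ℕ) (l : List Slot) :
    (placeSlots a l).map Block.obj = l.filterMap Slot.stored := by
  induction l generalizing a with
  | nil => rfl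
  | cons s l ih => cases s <;> simp [placeSlots, List.filterMap_cons, Slot.stored, ih]

theorem placeObjs_endpoint_le {a : ℕ} {l : List Obj} {y : Block} (hy : y ∈ placeObjs a l) :
    y.endpoint ≤ a + volume l := by
  simpa using placeSlots_endpoint_le hy

theorem obj_mem_of_mem_placeObjs {a : ℕ} {l : List Obj} {y : Block} (hy : y ∈ placeObjs a l) :
    y.obj ∈ l := by
  have := List.mem_map_of_mem (f := Block.obj) hy
  rwa [placeObjs, map_obj_placeSlots, filterMap_stored_map_obj] at this

theorem map_obj_layout (ε : ℝ) (a : ℕ) (R : State) :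
    (layout ε a R).map Block.obj = storedObjs R := by
  induction R generalizing a with
  | nil => rfl
  | cons r R ih =>
    simp only [layout, List.map_append, map_obj_placeSlots, ih, storedObjs_cons, Region.objs,
      Region.payloadObjs, Region.bufferObjs]

theorem layout_append (ε : ℝ) (a : ℕ) (R S : State) :
    layout ε a (R ++ S) = layout ε a R ++ layout ε (a + space ε R) S := by
  induction R generalizing a with
  | nil => rfl
  | cons r R ih => simp [layout, ih, Region.space, add_assoc]

theorem layout_endpoint_le {ε : ℝ} {a : ℕ} {R : State} {y : Block} (hy : y ∈ layout ε a R) :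
    y.endpoint ≤ a + space ε R + overflow ε R := by
  induction R generalizing a with
  | nil => cases hy
  | cons r R ih =>
    rw [layout, List.mem_append, List.mem_append] at hy
    rw [space_cons, overflow_cons]
    rcases hy with (hy | hy) | hy
    · have hle : y.endpoint ≤ a + r.payloadSize := placeSlots_endpoint_le hy
      omega
    · have hle : y.endpoint ≤ a + r.payloadSize + r.used := placeSlots_endpoint_le hy
      omega
    · have hle := ih hy
      rw [Region.space] at hle
      omega

theorem contentEnd_le (ε : ℝ) (R : State) : contentEnd ε R ≤ space ε R + overflow ε R := by
  rcases List.eq_nil_or_concat' R with rfl | ⟨S, r, rfl⟩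
  · exact Nat.zero_le _
  · have hspace : space ε [r] = r.payloadSize + r.capacity ε := space_cons ε r []
    have hoverflow : overflow ε [r] = r.used - r.capacity ε := overflow_cons ε r []
    simp only [contentEnd, List.dropLast_concat, List.getLast?_concat, Option.map_some,
      Option.getD_some, space_append, overflow_append]
    omega

theorem Inv.layout_endpoint_le {ε : ℝ} {A : List Obj} {R : State} (h : Inv ε A R)
    {y : Block} (hy : y ∈ layout ε 0 R) : y.endpoint ≤ space ε R := by
  simpa [h.fits] using Realloc.layout_endpoint_le hy

/-! ### Execution of a flush -/

theorem mem_memory_of_mem_scanl {as : List Action} {start m : Memory}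
    (hm : m ∈ as.scanl Memory.act start) {y : Block} (hy : y ∈ m.live ++ m.freed) :
    y ∈ start.live ++ start.freed ∨ Action.move y ∈ as := by
  induction as generalizing start with
  | nil =>
    rw [List.scanl_nil, List.mem_singleton] at hm
    exact Or.inl (hm ▸ hy)
  | cons a as ih =>
    rw [List.scanl_cons, List.mem_cons] at hm
    rcases hm with rfl | hm
    · exact Or.inl hy
    rcases ih hm with h | h
    · cases a with
      | move x =>
        simp only [Memory.act, List.mem_append, List.mem_filter, List.mem_singleton] at h
        rcases h with (h | rfl) | h | h
        · exact Or.inl (List.mem_append_left _ h.1)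
        · exact Or.inr List.mem_cons_self
        · exact Or.inl (List.mem_append_right _ h)
        · exact Or.inl (List.mem_append_left _ h.1)
      | checkpoint =>
        rw [Memory.act, List.append_nil] at h
        exact Or.inl (List.mem_append_left _ h)
    · exact Or.inr (List.mem_cons_of_mem _ h)

theorem mem_live_foldl {as : List Action} {start : Memory} {y : Block}
    (hy : y ∈ (as.foldl Memory.act start).live) :
    Action.move y ∈ as ∨ y ∈ start.live ∧ ∀ x, Action.move x ∈ as → x.obj ≠ y.obj := by
  induction as generalizing start with
  | nil => exact Or.inr ⟨hy, by simp⟩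
  | cons a as ih =>
    rcases ih hy with h | ⟨h, hne⟩
    · exact Or.inl (List.mem_cons_of_mem _ h)
    · cases a with
      | move x =>
        simp only [Memory.act, List.mem_append, List.mem_filter, List.mem_singleton,
          decide_eq_true_eq] at h
        rcases h with ⟨h, hx⟩ | rfl
        · refine Or.inr ⟨h, fun z hz => ?_⟩
          rcases List.mem_cons.1 hz with hz | hz
          · cases hz
            exact hx.symm
          · exact hne z hz
        · exact Or.inl List.mem_cons_self
      | checkpoint => exact Or.inr ⟨h, fun z hz => hne z (by simpa using hz)⟩

theorem move_mem_packPhases {bound v : ℕ} {l : List Block} {y : Block} :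
    Action.move y ∈ packPhases bound v l ↔ y ∈ l := by
  induction l generalizing v with
  | nil => simp [packPhases]
  | cons x l ih =>
    rw [packPhases]
    split_ifs <;> simp [ih]

theorem move_mem_unpackPhases {bound a : ℕ} {l : List Block} {y : Block} :
    Action.move y ∈ unpackPhases bound a l ↔ y ∈ l := by
  induction l generalizing a with
  | nil => simp [unpackPhases]
  | cons x l ih =>
    rw [unpackPhases]
    split_ifs <;> simp [ih]

section FlushActions

variable (ε : ℝ) (order : List Obj → List Obj) (b : ℕ) (R : State) (w Δ : ℕ)

/-- The location `M` behind which a flush puts the buffered objects. -/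
noncomputable def flushPivot : ℕ :=
  max (contentEnd ε R - w) (space ε (flushed order b R) - w) + totalCapacity ε (R.drop b) + Δ

/-- The steps (1) and (2) of a flush, with the moves to temporary locations around `M`. -/
noncomputable def outwardActions : List Action :=
  (placeObjs (flushPivot ε order b R w Δ) (evacuated order b R)).map .move ++ [.checkpoint] ++
  packPhases (totalCapacity ε (R.drop b) + Δ) 0
    (placeObjs (flushPivot ε order b R w Δ - volume ((R.drop b).flatMap Region.payloadObjs))
      ((R.drop b).flatMap Region.payloadObjs)).reverse

/-- The steps (3) and (4) of a flush, with the moves to final locations, except for the last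
checkpoint. -/
noncomputable def inwardActions : List Action :=
  unpackPhases (totalCapacity ε (R.drop b) + Δ) (space ε (R.take b))
    ((layout ε 0 (flushed order b R)).filter
      fun x => x.obj ∈ (R.drop b).flatMap Region.payloadObjs) ++
  ((evacuated order b R).flatMap fun o =>
    ((layout ε 0 (flushed order b R)).filter fun x => x.obj = o).map .move)

theorem flushActions_eq : flushActions ε order b R w Δ =
    outwardActions ε order b R w Δ ++ inwardActions ε order b R Δ ++ [.checkpoint] := by
  simp only [flushActions, outwardActions, inwardActions, flushPivot, totalCapacity,
    List.append_assoc]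

variable {ε order b R w Δ} {y : Block}

theorem move_mem_outwardActions : Action.move y ∈ outwardActions ε order b R w Δ ↔
    y ∈ placeObjs (flushPivot ε order b R w Δ) (evacuated order b R) ∨
    y ∈ placeObjs
      (flushPivot ε order b R w Δ - volume ((R.drop b).flatMap Region.payloadObjs))
      ((R.drop b).flatMap Region.payloadObjs) := by
  simp [outwardActions, move_mem_packPhases]

theorem move_mem_inwardActions : Action.move y ∈ inwardActions ε order b R Δ ↔
    y ∈ layout ε 0 (flushed order b R) ∧
      (y.obj ∈ (R.drop b).flatMap Region.payloadObjs ∨ y.obj ∈ evacuated order b R) := by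
  simp only [inwardActions, List.mem_append, move_mem_unpackPhases, List.mem_filter,
    decide_eq_true_eq, List.mem_flatMap (l := evacuated order b R), List.mem_map,
    Action.move.injEq, exists_eq_right]
  constructor
  · rintro (⟨h, h'⟩ | ⟨o, ho, h, rfl⟩)
    exacts [⟨h, Or.inl h'⟩, ⟨h, Or.inr ho⟩]
  · rintro ⟨h, h' | h'⟩
    exacts [Or.inl ⟨h, h'⟩, Or.inr ⟨_, h', h, rfl⟩]

theorem mem_layout_take_or_obj_mem_of_mem_live (horder : ∀ l, (order l).Perm l)
    {freed : List Block} (hy : y ∈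
      ((outwardActions ε order b R w Δ).foldl Memory.act ⟨layout ε 0 R, freed⟩).live) :
    y ∈ layout ε 0 (R.take b) ∨ y.obj ∈ storedObjs (R.drop b) := by
  have hperm := storedObjs_perm (R.drop b)
  rcases mem_live_foldl hy with hy | ⟨hy, -⟩
  · refine Or.inr (hperm.symm.subset (List.mem_append.2 ?_))
    rcases move_mem_outwardActions.1 hy with hy | hy
    · exact Or.inr ((evacuated_perm horder b R).subset (obj_mem_of_mem_placeObjs hy))
    · exact Or.inl (obj_mem_of_mem_placeObjs hy)
  · rw [← List.take_append_drop b R, layout_append, List.mem_append] at hy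
    refine hy.imp_right fun hy => ?_
    rw [← map_obj_layout]
    exact List.mem_map_of_mem hy

theorem FlushReady.exists_move_inwardActions {A : List Obj} (h : FlushReady ε b A R)
    (horder : ∀ l, (order l).Perm l) {o : Obj} (ho : o ∈ storedObjs (R.drop b)) :
    ∃ x, Action.move x ∈ inwardActions ε order b R Δ ∧ x.obj = o := by
  have hstored : o ∈ storedObjs (flushed order b R) := by
    refine ((h.inv_flushed horder).stores.perm.trans h.stores.perm.symm).symm.subset ?_
    rw [← List.take_append_drop b R, storedObjs_append]
    exact List.mem_append_right _ ho
  rw [← map_obj_layout ε 0] at hstored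
  obtain ⟨x, hx, rfl⟩ := List.mem_map.1 hstored
  refine ⟨x, move_mem_inwardActions.2 ⟨hx, ?_⟩, rfl⟩
  exact (List.mem_append.1 ((storedObjs_perm _).subset ho)).imp_right
    fun ho => (evacuated_perm horder b R).symm.subset ho

theorem FlushReady.live_endpoint_le {A : List Obj} (h : FlushReady ε b A R)
    (horder : ∀ l, (order l).Perm l) {freed : List Block} (hy : y ∈
      ((flushActions ε order b R w Δ).foldl Memory.act ⟨layout ε 0 R, freed⟩).live) :
    y.endpoint ≤ space ε (flushed order b R) := by
  rw [flushActions_eq, List.foldl_append, List.foldl_append] at hy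
  change y ∈ ((inwardActions ε order b R Δ).foldl Memory.act _).live at hy
  rcases mem_live_foldl hy with hy | ⟨hy, hne⟩
  · exact (h.inv_flushed horder).layout_endpoint_le (move_mem_inwardActions.1 hy).1
  rcases mem_layout_take_or_obj_mem_of_mem_live horder hy with hy | ho
  · exact (h.inv_take.layout_endpoint_le hy).trans (space_take_le_space_flushed ε order b R)
  · obtain ⟨x, hx, hxy⟩ := h.exists_move_inwardActions horder ho
    exact absurd hxy (hne x hx)

theorem foldl_flushActions_freed (start : Memory) :
    ((flushActions ε order b R w Δ).foldl Memory.act start).freed = [] := by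
  rw [flushActions_eq, List.foldl_append]
  rfl

theorem flushPivot_add_volume_evacuated_le (horder : ∀ l, (order l).Perm l)
    (hw : overflow ε R ≤ w) :
    flushPivot ε order b R w Δ + volume (evacuated order b R) ≤
      max (space ε R + w) (space ε (flushed order b R)) + 2 * totalCapacity ε (R.drop b) + Δ := by
  have hcontent := contentEnd_le ε R
  have hbuffer := volume_bufferObjs_add_volume_recordedObjs_le ε (R.drop b)
  have hoverflow := overflow_le_of_sublist ε (List.drop_sublist b R)
  rw [← volume_eq_of_perm (evacuated_perm horder b R)] at hbuffer
  rw [flushPivot]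
  omega

theorem FlushReady.endpoint_le_of_mem_scanl {A : List Obj} (h : FlushReady ε b A R)
    (horder : ∀ l, (order l).Perm l) (hw : overflow ε R ≤ w) {freed : List Block}
    (hfreed : ∀ x ∈ freed, x.endpoint ≤ space ε R) {m : Memory}
    (hm : m ∈ (flushActions ε order b R w Δ).scanl Memory.act ⟨layout ε 0 R, freed⟩)
    (hy : y ∈ m.live ++ m.freed) :
    y.endpoint ≤
      max (space ε R + w) (space ε (flushed order b R)) + 2 * totalCapacity ε (R.drop b) + Δ := by
  have hpivot : flushPivot ε order b R w Δ + volume (evacuated order b R) ≤ _ :=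
    flushPivot_add_volume_evacuated_le horder hw
  rcases mem_memory_of_mem_scanl hm hy with hy | hy
  · rcases List.mem_append.1 hy with hy | hy
    · have := layout_endpoint_le hy
      omega
    · have := hfreed y hy
      omega
  rw [flushActions_eq, List.mem_append, List.mem_append] at hy
  rcases hy with (hy | hy) | hy
  · rcases move_mem_outwardActions.1 hy with hy | hy
    · exact (placeObjs_endpoint_le hy).trans hpivot
    · have hpacked := placeObjs_endpoint_le hy
      have hvolume := volume_flatMap_payloadObjs_drop_le R b
      have hspace := space_eq_add ε R
      omega
  · have := (h.inv_flushed horder).layout_endpoint_le (move_mem_inwardActions.1 hy).1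
    omega
  · simp at hy

end FlushActions

/-! ### The bound on the footprint -/

theorem Moment.footprint_le {m : Moment} {n : ℕ} (hsegments : m.segmentsEnd ≤ n)
    (hblocks : ∀ y ∈ m.memory.live ++ m.memory.freed, y.endpoint ≤ n) : m.footprint ≤ n :=
  max_le hsegments (List.max_le_of_forall_le _ _ (List.forall_mem_map.2 hblocks))

/-- The bound of the theorem on the footprint at a given moment, with the constant `8`. -/
def Moment.Bounded (ε : ℝ) (m : Moment) : Prop :=
  (m.footprint : ℝ) ≤ (1 + 8 * ε) * (volume m.active : ℝ) + (longest m.active : ℝ)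

section Bounded

variable {ε : ℝ} (hε : 0 < ε) (hε' : ε ≤ 1 / 2)
include hε hε'

theorem one_add_three_mul_le {T V : ℝ} (hT : 0 ≤ T) (h : (1 - ε) * T ≤ V) :
    (1 + 3 * ε) * T ≤ (1 + 8 * ε) * V :=
  calc
    (1 + 3 * ε) * T ≤ (1 + 8 * ε) * (1 - ε) * T := by
      gcongr
      nlinarith
    _ ≤ (1 + 8 * ε) * V := by
      rw [mul_assoc]
      gcongr

theorem Inv.bounded_of_endpoint_le {A : List Obj} {R : State} (h : Inv ε A R) {μ : Memory}
    (hμ : ∀ y ∈ μ.live ++ μ.freed, y.endpoint ≤ space ε R) :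
    Moment.Bounded ε ⟨μ, space ε R, A⟩ :=
  calc
    ((Moment.mk μ (space ε R) A).footprint : ℝ) ≤ space ε R :=
      Nat.cast_le.2 (Moment.footprint_le le_rfl hμ)
    _ ≤ (1 + ε) * totalPayload R := space_le hε.le R
    _ ≤ (1 + 3 * ε) * totalPayload R := by
      gcongr
      linarith
    _ ≤ (1 + 8 * ε) * volume A :=
      one_add_three_mul_le hε hε' (Nat.cast_nonneg _) (h.totalPayload_le hε.le)
    _ ≤ (1 + 8 * ε) * volume A + longest A := le_add_of_nonneg_right (Nat.cast_nonneg _)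

theorem Inv.bounded_layout {A : List Obj} {R : State} (h : Inv ε A R) :
    Moment.Bounded ε ⟨⟨layout ε 0 R, []⟩, space ε R, A⟩ :=
  h.bounded_of_endpoint_le hε hε' fun _ hy => h.layout_endpoint_le (by simpa using hy)

theorem max_space_add_totalCapacity_le {R R' : State} {w : ℕ} {V : ℝ}
    (hR : (1 - ε) * (totalPayload R + w) ≤ V) (hR' : (1 - ε) * totalPayload R' ≤ V) :
    max (space ε R + w : ℝ) (space ε R') + 2 * totalCapacity ε R ≤ (1 + 8 * ε) * V := by
  set T : ℝ := max (totalPayload R + w) (totalPayload R')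
  have hT : (totalPayload R + w : ℝ) ≤ T := le_max_left _ _
  have hT' : (totalPayload R' : ℝ) ≤ T := le_max_right _ _
  have hcapacity : (totalCapacity ε R : ℝ) ≤ ε * T :=
    (totalCapacity_le hε.le R).trans <| by
      gcongr
      exact (le_add_of_nonneg_right (Nat.cast_nonneg w)).trans hT
  have hspace : (space ε R : ℝ) + w ≤ (1 + ε) * T :=
    calc
      (space ε R : ℝ) + w ≤ (1 + ε) * totalPayload R + (1 + ε) * w :=
        add_le_add (space_le hε.le R)
          (le_mul_of_one_le_left (Nat.cast_nonneg w) (by linarith))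
      _ = (1 + ε) * (totalPayload R + w) := by ring
      _ ≤ (1 + ε) * T := by gcongr
  have hspace' : (space ε R' : ℝ) ≤ (1 + ε) * T :=
    (space_le hε.le R').trans (by gcongr)
  calc
    max (space ε R + w : ℝ) (space ε R') + 2 * totalCapacity ε R
        ≤ (1 + ε) * T + 2 * (ε * T) := by
      gcongr
      exact max_le hspace hspace'
    _ = (1 + 3 * ε) * T := by ring
    _ ≤ (1 + 8 * ε) * V :=
      one_add_three_mul_le hε hε' ((Nat.cast_nonneg _).trans hT') <| by
        rw [mul_max_of_nonneg _ _ (by linarith)]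
        exact max_le hR hR'

theorem FlushReady.bounded_flushMoments {order : List Obj → List Obj}
    (horder : ∀ l, (order l).Perm l) {b w : ℕ} {A A' : List Obj} {R : State}
    (h : FlushReady ε b A' R) (hA : volume A' ≤ volume A) (hw : overflow ε R ≤ w)
    (hR : (1 - ε) * (totalPayload R + w) ≤ volume A)
    {freed : List Block} (hfreed : ∀ y ∈ freed, y.endpoint ≤ space ε R) {m : Moment}
    (hm : m ∈ flushMoments ε order b R w ⟨layout ε 0 R, freed⟩ A A') : m.Bounded ε := by
  have hinv := h.inv_flushed horder
  rw [flushMoments, List.mem_append, List.mem_map, List.mem_singleton] at hm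
  rcases hm with ⟨μ, hμ, rfl⟩ | rfl
  · have hmax := max_space_add_totalCapacity_le hε hε' hR
      ((hinv.totalPayload_le hε.le).trans (Nat.cast_le.2 hA))
    have hfootprint := Moment.footprint_le
      (m := ⟨μ, max (space ε R) (space ε (flushed order b R)), A⟩) (by dsimp only; omega)
      fun y hy => h.endpoint_le_of_mem_scanl horder hw hfreed hμ hy
    have hdrop := totalCapacity_le_of_sublist ε (List.drop_sublist b R)
    rw [Moment.Bounded]
    refine le_trans ?_ (add_le_add_left hmax _)
    exact_mod_cast hfootprint.trans (by gcongr)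
  · rw [List.getLastD_eq_getLast?, List.getLast?_scanl, Option.getD_some]
    refine hinv.bounded_of_endpoint_le hε hε' fun y hy => ?_
    rw [foldl_flushActions_freed, List.append_nil] at hy
    exact h.live_endpoint_le horder hy

end Bounded

/-! ### Processing requests -/

theorem Inv.flushReady_appendToBuffer_obj {ε : ℝ} {A : List Obj} {R : State} (h : Inv ε A R)
    {o : Obj} (hwf : WellFormed (A ++ [o])) (hc : sizeClass o.size < R.length) :
    FlushReady ε (boundary (appendToBuffer (R.length - 1) (.obj o) R) (sizeClass o.size))
      (A ++ [o]) (appendToBuffer (R.length - 1) (.obj o) R) where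
  wellFormed := hwf
  stores := h.stores.appendToBuffer (s := .obj o) (by omega)
    (by simpa [Slot.subject] using Nat.le_sub_one_of_lt hc)
  isFlushBoundary := isFlushBoundary_boundary _ _
  fits_take := by
    rw [take_appendToBuffer ((boundary_le _ _).trans (by omega))]
    exact Nat.le_zero.1 ((overflow_le_of_sublist ε (List.take_sublist _ _)).trans h.fits.le)
  recorded i _ := (h.recorded i).appendToBuffer (by omega) _

theorem Inv.flushReady_eraseObj {ε : ℝ} {A : List Obj} {R : State} (h : Inv ε A R)
    {o : Obj} (ho : o ∈ A) :
    FlushReady ε (boundary (eraseObj o.name R) (sizeClass o.size))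
      (A.filter fun p => p.name ≠ o.name) (eraseObj o.name R) where
  wellFormed := h.wellFormed.sublist List.filter_sublist
  stores := h.stores.eraseObj o.name
  isFlushBoundary := isFlushBoundary_boundary _ _
  fits_take := by
    refine Nat.le_zero.1 ((overflow_le_of_sublist ε (List.take_sublist _ _)).trans ?_)
    rw [overflow_eraseObj, h.fits]
  recorded i hi :=
    (h.recorded i).eraseObj h.stores h.wellFormed ho (hi.trans_le (boundary_le _ _)).ne'

/-- What is to be shown for the moments of a request and the data structure that results from it,
`A` being the objects active afterwards. -/
structure Sound (ε : ℝ) (A : List Obj) (x : List Moment × State) : Prop where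
  bounded : ∀ m ∈ x.1, m.Bounded ε
  inv : Inv ε A x.2

section Sound

variable {ε : ℝ} (hε : 0 < ε) (hε' : ε ≤ 1 / 2) {order : List Obj → List Obj}
  (horder : ∀ l, (order l).Perm l) {A : List Obj} {R : State}
include hε hε'

theorem Inv.sound (h : Inv ε A R) :
    Sound ε A ([⟨⟨layout ε 0 R, []⟩, space ε R, A⟩], R) :=
  ⟨by simpa using h.bounded_layout hε hε', h⟩

include horder

theorem insertObj_sound (h : Inv ε A R) {o : Obj} (hwf : WellFormed (A ++ [o])) :
    Sound ε (A ++ [o]) (insertObj ε order R A o) := by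
  rw [insertObj]
  split_ifs with hc
  · exact (h.append_newRegion hwf hc).sound hε hε'
  rcases hj : findBuffer ε R (sizeClass o.size) o.size with _ | j
  · have hready := h.flushReady_appendToBuffer_obj hwf (not_le.1 hc)
    refine ⟨fun m => hready.bounded_flushMoments hε hε' horder le_rfl ?_ ?_ (by simp),
      hready.inv_flushed horder⟩
    · have := overflow_appendToBuffer_le (R := R) (j := R.length - 1) (by omega) (.obj o) ε
      rwa [h.fits, zero_add] at this
    · have hle : (1 - ε) * (totalPayload R + o.size) ≤ volume A + o.size := by
        have : (0 : ℝ) ≤ ε * o.size := by positivity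
        linarith [h.totalPayload_le hε.le]
      simpa [totalPayload_appendToBuffer (show R.length - 1 < R.length by omega)] using hle
  · exact (h.appendToBuffer_obj hwf hj).sound hε hε'

theorem deleteObj_sound (h : Inv ε A R) {o : Obj} (ho : o ∈ A) :
    Sound ε (A.filter fun p => p.name ≠ o.name) (deleteObj ε order R A o) := by
  have hold : ∀ y ∈ (layout ε 0 R).filter (fun x => x.obj.name = o.name),
      y.endpoint ≤ space ε R := fun y hy => h.layout_endpoint_le (List.mem_of_mem_filter hy)
  have hstart := h.bounded_layout hε hε'
  rw [deleteObj]
  rcases hj : findBuffer ε (eraseObj o.name R) (sizeClass o.size) o.size with _ | j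
  · have hready := h.flushReady_eraseObj ho
    refine ⟨List.forall_mem_cons.2 ⟨hstart, fun m => hready.bounded_flushMoments hε hε' horder
      (volume_filter_le _ A) ?_ ?_ ?_⟩, hready.inv_flushed horder⟩
    · rw [overflow_eraseObj, h.fits]
    · simpa [totalPayload_eraseObj] using h.totalPayload_le hε.le
    · rwa [space_eraseObj]
  · have hinv := h.eraseObj_appendToBuffer_record ho hj
    refine ⟨List.forall_mem_cons.2 ⟨hstart, List.forall_mem_singleton.2 ?_⟩, hinv⟩
    refine hinv.bounded_of_endpoint_le hε hε' fun y hy => ?_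
    rcases List.mem_append.1 hy with hy | hy
    · exact hinv.layout_endpoint_le hy
    · obtain ⟨-, r, hr, -⟩ := findBuffer_eq_some hj
      rw [space_appendToBuffer (List.getElem?_eq_some_iff.1 hr).1, space_eraseObj]
      exact hold y hy

theorem process_sound (h : Inv ε A R) {q : Request} (hq : q.Admissible A) :
    Sound ε (activeStep A q) (process ε order R A q) := by
  cases q with
  | insert n w =>
    exact insertObj_sound hε hε' horder h (h.wellFormed.append_singleton hq.1 hq.2)
  | delete n =>
    rw [process]
    rcases ho : A.find? fun o => o.name = n with _ | o
    · obtain ⟨o, hoA, hname⟩ := hq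
      simpa [hname] using List.find?_eq_none.1 ho o hoA
    · obtain rfl : o.name = n := by simpa using List.find?_some ho
      rw [ho]
      exact deleteObj_sound hε hε' horder h (List.mem_of_find?_eq_some ho)

theorem bounded_of_mem_execution (h : Inv ε A R) {requests : List Request}
    (hrequests : Admissible A requests) {m : Moment}
    (hm : m ∈ execution ε order R A requests) : m.Bounded ε := by
  induction requests generalizing A R with
  | nil => cases hm
  | cons q qs ih =>
    have hsound := process_sound hε hε' horder h hrequests.1
    rcases List.mem_append.1 hm with hm | hm
    · exact hsound.bounded m hm
    · exact ih hsound.inv hrequests.2 hm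

end Sound

end Realloc

theorem mainTheorem3 :
    ∃ C : ℝ, 0 < C ∧
      ∀ ε : ℝ, 0 < ε → ε ≤ 1 / 2 →
      ∀ order : List Realloc.Obj → List Realloc.Obj, (∀ l, (order l).Perm l) →
      ∀ requests : List Realloc.Request, Realloc.Admissible [] requests →
      ∀ m ∈ Realloc.execution ε order [] [] requests,
        (m.footprint : ℝ) ≤
          (1 + C * ε) * (Realloc.volume m.active : ℝ) + (Realloc.longest m.active : ℝ) :=
  ⟨8, by norm_num, fun ε hε hε' _ horder _ hrequests _ hm =>
    Realloc.bounded_of_mem_execution hε hε' horder (Realloc.inv_nil ε) hrequests hm⟩
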